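/- Let $\mathbb{F}_q$ be the finite field with $q$ elements, let $m\ge 1$ be an integer, and let $0\le u\le m(q-1)$. Let $\mathrm{RM}_q(u,m)\subseteq \mathbb{F}_q^{q^m}$ be the Reed–Muller code of order $u$ in $m$ variables, i.e. the set of all vectors $(f(P))_{P\in\mathbb{F}_q^m}$ where $f\in\mathbb{F}_q[X_1,\dots,X_m]$ has total degree at most $u$. A minimum weight codeword is a nonzero codeword whose Hamming weight (number of nonzero coordinates) is least among all nonzero codewords; let $\mathrm{N}_q(u,m)$ be the set of minimum weight codewords of $\mathrm{RM}_q(u,m)$. For integers $0\le k\le n$ let $\binom{n}{k}_q$ denote the number of $k$-dimensional linear subspaces of $\mathbb{F}_q^n$. Then there are unique integers $t,s$ with $0\le t\le m$, $0\le s<q-1$ and $u=t(q-1)+s$, and $$ |\mathrm{N}_q(u,m)|=\begin{cases}(q-1)\,q^t\,\dbinom{m}{t}_q & \text{if } s=0,\\[1em] (q-1)\,q^t\,\dbinom{m}{t}_q\dbinom{m-t}{1}_q\dbinom{q}{s} & \text{if } s\ne 0.\end{cases} $$ -/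

import Mathlib

/-- The Reed–Muller code of order `u` in `m` variables over the finite field `F`: all evaluation
vectors, indexed by the points of `F ^ m`, of polynomials of total degree at most `u`. -/
noncomputable def reedMuller (F : Type*) [Field F] (u m : ℕ) : Submodule F ((Fin m → F) → F) :=
  (MvPolynomial.restrictTotalDegree (Fin m) F u).map (MvPolynomial.evalₗ F (Fin m))

/-- The minimum weight codewords of a linear code `C`: the nonzero codewords whose Hamming weight
is least among those of all nonzero codewords. -/
def minWeightCodewords {F ι : Type*} [Field F] [DecidableEq F] [Fintype ι]
    (C : Submodule F (ι → F)) : Set (ι → F) :=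
  {c | c ∈ C ∧ c ≠ 0 ∧ ∀ c' ∈ C, c' ≠ 0 → hammingNorm c ≤ hammingNorm c'}

/-- The `q`-binomial coefficient, `q = |F|`: the number of `k`-dimensional linear subspaces
of `F ^ n`. -/
noncomputable def qBinomial (F : Type*) [Field F] (n k : ℕ) : ℕ :=
  Nat.card {W : Submodule F (Fin n → F) // Module.finrank F W = k}

/-!
Fix a nonzero linear form `l` and a nonzero function `f` of degree at most `u` on an
`m`-dimensional space. If `f` vanishes on exactly `k` of the `q` levels of `l`, it is a product of
`k` affine forms and a function of degree at most `u - k`, so that its restriction to each of the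
other `q - k` levels has degree at most `u - k`. By induction on `m` the weight of `f` is at least
the minimum of the products `∏ (q - kᵢ)` with `kᵢ < q` and `∑ kᵢ ≤ u`, and if `f` attains it then
`k` is `0`, `s` or `q - 1`, where `u = t (q - 1) + s` and `s < q - 1`, and all nonvanishing levels
have the same weight.

Let `f` be of minimum weight and `t > 0`. Averaging over all linear forms, with a zero of `f`
fixed, gives a form with `k ≠ 0`. If `k = s`, then by induction the support of `f` on every
nonvanishing level is a flat of codimension `t + 1`, and a form that is constant on one such flat
together with a point of another level has `k = q - 1`. So `f` lives on a hyperplane, and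
descending `t` times it lives on a flat of codimension `t`, where it has minimum weight among the
functions of degree at most `s`, hence is a scalar times a product of `s` distinct parallel affine
forms. Conversely, extending such a function by zero multiplies it by the indicator of the flat, of
degree `t (q - 1)`. The flat is determined by `f`, because the support fills more than one `q`-th
of it, so it remains to count flats and products.
-/

theorem mul_eq_mul_add_of_add_eq {a b c d : ℕ} (h : a + b = c + d) (hca : c ≤ a) (hcb : c ≤ b) :
    a * b = c * d + (a - c) * (b - c) := by
  obtain ⟨i, rfl⟩ := Nat.exists_eq_add_of_le hca
  obtain ⟨j, rfl⟩ := Nat.exists_eq_add_of_le hcb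
  obtain rfl : d = c + i + j := by omega
  simp only [Nat.add_sub_cancel_left]
  ring

theorem existsUnique_mul_add {m n u : ℕ} (hn : 0 < n) (hu : u ≤ m * n) :
    ∃! p : ℕ × ℕ, p.1 ≤ m ∧ p.2 < n ∧ u = p.1 * n + p.2 := by
  refine ⟨(u / n, u % n), ⟨Nat.div_le_of_le_mul (by rwa [mul_comm]), Nat.mod_lt _ hn,
    (Nat.div_add_mod' _ _).symm⟩, ?_⟩
  rintro ⟨t, s⟩ ⟨-, hs, rfl⟩
  have hs : s < n := hs
  ext
  · simp [Nat.add_div_of_dvd_right (Dvd.intro_left t rfl), Nat.mul_div_cancel _ hn,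
      Nat.div_eq_of_lt hs]
  · simp [Nat.mod_eq_of_lt hs]

section MinDist

variable {q m u k : ℕ}

/-- The minimum distance of the Reed–Muller code of order `u` in `m` variables over a field with
`q` elements. It is the least product `∏ (q - kᵢ)` over sequences of `m` numbers `kᵢ < q` with
sum at most `u`, which is attained by choosing the `kᵢ` greedily, and is encoded by this greedy
recursion. -/
def minDist (q : ℕ) : ℕ → ℕ → ℕ
  | 0, _ => 1
  | m + 1, u => (q - min u (q - 1)) * minDist q m (u - min u (q - 1))

theorem minDist_pos (hq : 0 < q) (m u : ℕ) : 0 < minDist q m u := by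
  induction m generalizing u with
  | zero => exact one_pos
  | succ m ih => exact Nat.mul_pos (by omega) (ih _)

theorem minDist_zero_right (q m : ℕ) : minDist q m 0 = q ^ m := by
  induction m with
  | zero => rfl
  | succ m ih => simp [minDist, ih, pow_succ']

theorem minDist_of_lt (hu : u < q) : minDist q (m + 1) u = (q - u) * q ^ m := by
  rw [minDist, min_eq_left (by omega), Nat.sub_self, minDist_zero_right]

theorem minDist_le_pow (q m u : ℕ) : minDist q m u ≤ q ^ m := by
  induction m generalizing u with
  | zero => rfl
  | succ m ih =>
    rw [minDist, pow_succ']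
    exact Nat.mul_le_mul (Nat.sub_le _ _) (ih _)

theorem minDist_lt_pow (hq : 1 < q) (hu : 0 < u) : minDist q (m + 1) u < q ^ (m + 1) := by
  rw [minDist, pow_succ']
  exact Nat.mul_lt_mul_of_lt_of_le (by omega) (minDist_le_pow q m _) (by positivity)

theorem minDist_mul_add {t s : ℕ} (hq : 0 < q) (ht : t ≤ m) :
    minDist q m (t * (q - 1) + s) = minDist q (m - t) s := by
  induction t generalizing m with
  | zero => simp
  | succ t ih =>
    obtain ⟨m, rfl⟩ := Nat.exists_eq_add_of_le' (show 1 ≤ m by omega)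
    have hu : (t + 1) * (q - 1) + s = t * (q - 1) + s + (q - 1) := by ring
    rw [minDist, hu, min_eq_right (Nat.le_add_left _ _), Nat.add_sub_cancel, ih (by omega),
      Nat.add_sub_add_right, show q - (q - 1) = 1 by omega, one_mul]

theorem pow_lt_mul_minDist {s : ℕ} (hs : s < q - 1) (m : ℕ) : q ^ m < q * minDist q m s := by
  cases m with
  | zero => simp only [minDist, pow_zero]; omega
  | succ m =>
    rw [minDist_of_lt (by omega), pow_succ']
    have hpow : 0 < q ^ m := pow_pos (by omega) m
    exact Nat.mul_lt_mul_of_pos_left (by nlinarith [show 2 ≤ q - s by omega]) (by omega)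

theorem sub_mul_sub_eq_greedy_add (hk : k < q) (hku : k ≤ u) :
    (q - k) * (q - min (u - k) (q - 1)) =
      (q - min u (q - 1)) * (q - (k + min (u - k) (q - 1) - min u (q - 1))) +
        (min u (q - 1) - k) * (min u (q - 1) - min (u - k) (q - 1)) := by
  rw [mul_eq_mul_add_of_add_eq (c := q - min u (q - 1))
    (d := q - (k + min (u - k) (q - 1) - min u (q - 1))) (by omega) (by omega) (by omega)]
  congr 2 <;> omega

theorem minDist_le_mul (hk : k < q) (hku : k ≤ u) :
    minDist q (m + 1) u ≤ (q - k) * minDist q m (u - k) := by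
  induction m generalizing u k with
  | zero => simp only [minDist, mul_one]; omega
  | succ m ih =>
    set K := min u (q - 1)
    set k' := min (u - k) (q - 1)
    calc minDist q (m + 1 + 1) u
        = (q - K) * minDist q (m + 1) (u - K) := rfl
      _ ≤ (q - K) * ((q - (k + k' - K)) * minDist q m (u - K - (k + k' - K))) :=
          Nat.mul_le_mul_left _ (ih (by omega) (by omega))
      _ = (q - K) * (q - (k + k' - K)) * minDist q m (u - k - k') := by
          rw [mul_assoc, show u - K - (k + k' - K) = u - k - k' by omega]
      _ ≤ (q - k) * (q - k') * minDist q m (u - k - k') := by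
          rw [sub_mul_sub_eq_greedy_add hk hku]
          exact Nat.mul_le_mul_right _ (Nat.le_add_right _ _)
      _ = (q - k) * minDist q (m + 1) (u - k) := by rw [minDist, mul_assoc]

theorem eq_min_and_minDist_eq_mul (hk : k < q) (hku : k ≤ u) (hmin : k ≠ min u (q - 1))
    (h : minDist q (m + 2) u = (q - k) * minDist q (m + 1) (u - k)) :
    min (u - k) (q - 1) = min u (q - 1) ∧
      minDist q (m + 1) (u - min u (q - 1)) =
        (q - k) * minDist q m (u - min u (q - 1) - k) := by
  set K := min u (q - 1)
  set k' := min (u - k) (q - 1)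
  have hpos : 0 < minDist q m (u - k - k') := minDist_pos (by omega) _ _
  have hle : minDist q (m + 1) (u - K) ≤
      (q - (k + k' - K)) * minDist q m (u - K - (k + k' - K)) :=
    minDist_le_mul (by omega) (by omega)
  have hexchange := sub_mul_sub_eq_greedy_add hk hku
  have heq : k' = K := by
    by_contra hne
    have : 0 < (K - k) * (K - k') := Nat.mul_pos (by omega) (by omega)
    refine h.not_lt ?_
    calc minDist q (m + 2) u
        = (q - K) * minDist q (m + 1) (u - K) := rfl
      _ ≤ (q - K) * ((q - (k + k' - K)) * minDist q m (u - k - k')) := by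
          rw [show u - k - k' = u - K - (k + k' - K) by omega]
          exact Nat.mul_le_mul_left _ hle
      _ < (q - k) * (q - k') * minDist q m (u - k - k') := by
          rw [hexchange, ← mul_assoc]
          exact Nat.mul_lt_mul_of_pos_right (Nat.lt_add_of_pos_right this) hpos
      _ = (q - k) * minDist q (m + 1) (u - k) := by rw [minDist, mul_assoc]
  refine ⟨heq, Nat.eq_of_mul_eq_mul_left (show 0 < q - K by omega) ?_⟩
  calc (q - K) * minDist q (m + 1) (u - K)
      = minDist q (m + 2) u := rfl
    _ = (q - k) * minDist q (m + 1) (u - k) := h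
    _ = (q - k) * ((q - k') * minDist q m (u - k - k')) := rfl
    _ = (q - K) * ((q - k) * minDist q m (u - K - k)) := by
        rw [heq, Nat.sub_right_comm, mul_left_comm]

theorem eq_of_minDist_eq_mul (hk : k < q) (hku : k ≤ u)
    (h : minDist q (m + 1) u = (q - k) * minDist q m (u - k)) :
    k = 0 ∨ k = u % (q - 1) ∨ k = q - 1 := by
  induction m generalizing u k with
  | zero =>
    have hmin : k = min u (q - 1) := by simp only [minDist, mul_one] at h; omega
    rcases lt_or_ge u (q - 1) with hu | hu
    · rw [Nat.mod_eq_of_lt hu]; omega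
    · omega
  | succ m ih =>
    rcases eq_or_ne k (min u (q - 1)) with hmin | hmin
    · rcases lt_or_ge u (q - 1) with hu | hu
      · rw [Nat.mod_eq_of_lt hu]; omega
      · omega
    have hstep := eq_min_and_minDist_eq_mul hk hku hmin h
    rcases lt_or_ge u (q - 1) with hu | hu
    · omega
    · rw [min_eq_right hu] at hstep
      rw [Nat.mod_eq_sub_mod hu]
      exact ih hk (by omega) hstep.2

end MinDist

section PolyFun

variable (R V : Type*) [CommRing R] [AddCommGroup V] [Module R V]

/-- The space of affine functions `V → R`. -/
def affineFunctions : Submodule R (V → R) where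
  carrier := {f | ∃ α : V →ᵃ[R] R, ⇑α = f}
  add_mem' := by
    rintro _ _ ⟨α, rfl⟩ ⟨β, rfl⟩
    exact ⟨α + β, AffineMap.coe_add α β⟩
  zero_mem' := ⟨0, AffineMap.coe_zero⟩
  smul_mem' := by
    rintro c _ ⟨α, rfl⟩
    exact ⟨c • α, AffineMap.coe_smul c α⟩

/-- The functions on a vector space that are given by polynomials of degree at most `u`. To have
this notion without coordinates, it is encoded as the space of linear combinations of products of
`u` affine functions. -/
def polyFun (u : ℕ) : Submodule R (V → R) := affineFunctions R V ^ u

instance : SetLike.GradedMonoid (polyFun R V) := Submodule.nat_power_gradedMonoid _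

variable {R V}

theorem affineMap_mem_polyFun_one (α : V →ᵃ[R] R) : ⇑α ∈ polyFun R V 1 := by
  rw [polyFun, pow_one]
  exact ⟨α, rfl⟩

theorem dual_sub_const_mem_polyFun_one (l : Module.Dual R V) (b : R) :
    (fun x => l x - b) ∈ polyFun R V 1 := by
  convert affineMap_mem_polyFun_one (l.toAffineMap - AffineMap.const R V b)
  simp

theorem polyFun_mono : Monotone (polyFun R V) := by
  refine pow_right_mono₀ fun f hf => ?_
  obtain ⟨c, rfl⟩ := Submodule.mem_one.1 hf
  exact ⟨AffineMap.const R V c, rfl⟩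

theorem mem_polyFun_zero {f : V → R} : f ∈ polyFun R V 0 ↔ ∃ c, f = fun _ => c := by
  rw [polyFun, pow_zero, Submodule.mem_one]
  exact exists_congr fun c => eq_comm

theorem const_mem_polyFun (c : R) (u : ℕ) : (fun _ => c) ∈ polyFun R V u :=
  polyFun_mono u.zero_le (mem_polyFun_zero.2 ⟨c, rfl⟩)

theorem comp_affineMap_mem_polyFun {W : Type*} [AddCommGroup W] [Module R W] (φ : W →ᵃ[R] V)
    {u : ℕ} {f : V → R} (hf : f ∈ polyFun R V u) : f ∘ φ ∈ polyFun R W u := by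
  induction hf using Submodule.pow_induction_on_left' with
  | algebraMap r => exact const_mem_polyFun r 0
  | add f g i _ _ hf hg => exact add_mem hf hg
  | mem_mul α hα i f _ hf =>
    obtain ⟨α, rfl⟩ := hα
    rw [Nat.succ_eq_one_add]
    exact SetLike.mul_mem_graded (affineMap_mem_polyFun_one (α.comp φ)) hf

/-- The affine projection onto the hyperplane `l = b` along `v`, where `l v = 1`. -/
def hyperplaneProj (l : Module.Dual R V) (v : V) (b : R) : V →ᵃ[R] V :=
  AffineMap.id R V - (LinearMap.toSpanSingleton R V v ∘ₗ l).toAffineMap +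
    AffineMap.const R V (b • v)

theorem hyperplaneProj_apply (l : Module.Dual R V) (v : V) (b : R) (x : V) :
    hyperplaneProj l v b x = x - (l x - b) • v := by
  change x - l x • v + b • v = _
  rw [sub_add, sub_smul]

theorem affineMap_apply_eq_hyperplaneProj_add (l : Module.Dual R V) (v : V) (b : R)
    (α : V →ᵃ[R] R) (x : V) :
    α x = α (hyperplaneProj l v b x) + (l x - b) * α.linear v := by
  have hx : x = (l x - b) • v +ᵥ hyperplaneProj l v b x := by
    rw [hyperplaneProj_apply, vadd_eq_add, add_sub_cancel]
  conv_lhs => rw [hx, AffineMap.map_vadd, map_smul, vadd_eq_add, smul_eq_mul, add_comm]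

theorem exists_eq_comp_hyperplaneProj_add (l : Module.Dual R V) (v : V) (b : R) {u : ℕ}
    {f : V → R} (hf : f ∈ polyFun R V (u + 1)) :
    ∃ g ∈ polyFun R V u, f = f ∘ hyperplaneProj l v b + (fun x => l x - b) * g := by
  induction u generalizing f with
  | zero =>
    rw [polyFun, zero_add, pow_one] at hf
    obtain ⟨α, rfl⟩ := hf
    exact ⟨fun _ => α.linear v, const_mem_polyFun _ _,
      funext (affineMap_apply_eq_hyperplaneProj_add l v b α)⟩
  | succ u ih =>
    rw [polyFun, pow_succ'] at hf
    induction hf using Submodule.mul_induction_on' with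
    | mem_mul_mem α hα f hf =>
      obtain ⟨α, rfl⟩ := hα
      obtain ⟨g, hg, hfg⟩ := ih hf
      refine ⟨α.linear v • f + α.comp (hyperplaneProj l v b) * g,
        add_mem (Submodule.smul_mem _ _ hf) ?_, funext fun x => ?_⟩
      · rw [add_comm u 1]
        exact SetLike.mul_mem_graded (affineMap_mem_polyFun_one _) hg
      · have hα := affineMap_apply_eq_hyperplaneProj_add l v b α x
        have hf := congrFun hfg x
        simp only [Pi.add_apply, Pi.mul_apply, Pi.smul_apply, Function.comp_apply, smul_eq_mul,
          AffineMap.coe_comp] at hf ⊢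
        linear_combination f x * hα + α (hyperplaneProj l v b x) * hf
    | add f₁ _ f₂ _ h₁ h₂ =>
      obtain ⟨g₁, hg₁, h₁⟩ := h₁
      obtain ⟨g₂, hg₂, h₂⟩ := h₂
      refine ⟨g₁ + g₂, add_mem hg₁ hg₂, funext fun x => ?_⟩
      have h₁ := congrFun h₁ x
      have h₂ := congrFun h₂ x
      simp only [Pi.add_apply, Pi.mul_apply, Function.comp_apply] at h₁ h₂ ⊢
      linear_combination h₁ + h₂

/-- The function `∏ b ∈ B, (l x - b)`, which vanishes on the hyperplanes `l = b` for `b ∈ B`. -/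
def hyperplaneProd (l : Module.Dual R V) (B : Finset R) : V → R :=
  ∏ b ∈ B, fun x => l x - b

theorem hyperplaneProd_apply (l : Module.Dual R V) (B : Finset R) (x : V) :
    hyperplaneProd l B x = ∏ b ∈ B, (l x - b) :=
  Finset.prod_apply ..

theorem hyperplaneProd_mem_polyFun (l : Module.Dual R V) (B : Finset R) :
    hyperplaneProd l B ∈ polyFun R V B.card := by
  simpa [hyperplaneProd] using SetLike.prod_mem_graded (polyFun R V) (fun _ => 1)
    (fun b x => l x - b) fun b (_ : b ∈ B) => dual_sub_const_mem_polyFun_one l b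

end PolyFun

section Vanishing

variable {F V : Type*} [Field F] [AddCommGroup V] [Module F V]

theorem exists_eq_mul_of_vanish {l : Module.Dual F V} (hl : l ≠ 0) {b : F} {u : ℕ}
    {f : V → F} (hf : f ∈ polyFun F V (u + 1)) (hb : ∀ x, l x = b → f x = 0) :
    ∃ g ∈ polyFun F V u, f = (fun x => l x - b) * g := by
  obtain ⟨v, hv⟩ := LinearMap.surjective hl 1
  obtain ⟨g, hg, hfg⟩ := exists_eq_comp_hyperplaneProj_add l v b hf
  have hproj : f ∘ hyperplaneProj l v b = 0 :=
    funext fun x => hb _ (by simp [hyperplaneProj_apply, hv])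
  exact ⟨g, hg, by rwa [hproj, zero_add] at hfg⟩

theorem hyperplaneProd_apply_eq_zero {l : Module.Dual F V} {B : Finset F} {x : V} :
    hyperplaneProd l B x = 0 ↔ l x ∈ B := by
  simp [hyperplaneProd_apply, Finset.prod_eq_zero_iff, sub_eq_zero]

theorem exists_eq_hyperplaneProd_mul_of_vanish {l : Module.Dual F V} (hl : l ≠ 0) {u : ℕ}
    {f : V → F} (hf : f ∈ polyFun F V u) (hf0 : f ≠ 0) {B : Finset F}
    (hB : ∀ x, l x ∈ B → f x = 0) :
    ∃ n, ∃ g ∈ polyFun F V n, n + B.card = u ∧ f = hyperplaneProd l B * g := by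
  classical
  induction B using Finset.induction_on with
  | empty => exact ⟨u, f, hf, by simp, by simp [hyperplaneProd]⟩
  | insert b B hb ih =>
    obtain ⟨n, g, hg, rfl, rfl⟩ := ih fun x hx => hB x (Finset.mem_insert_of_mem hx)
    have hgb (x : V) (hx : l x = b) : g x = 0 :=
      (mul_eq_zero.1 (hB x (by simp [hx]))).resolve_left
        (hyperplaneProd_apply_eq_zero.not.2 (hx ▸ hb))
    have hn : n ≠ 0 := by
      rintro rfl
      obtain ⟨c, rfl⟩ := mem_polyFun_zero.1 hg
      obtain ⟨x, hx⟩ := LinearMap.surjective hl b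
      obtain rfl : c = 0 := hgb x hx
      exact hf0 (mul_zero _)
    obtain ⟨n, rfl⟩ := Nat.exists_eq_succ_of_ne_zero hn
    obtain ⟨g', hg', rfl⟩ := exists_eq_mul_of_vanish hl hg hgb
    refine ⟨n, g', hg', by rw [Finset.card_insert_of_notMem hb]; omega, ?_⟩
    rw [hyperplaneProd, hyperplaneProd, Finset.prod_insert hb, ← mul_assoc,
      mul_comm (Finset.prod _ _)]

end Vanishing

section Weight

/-- The Hamming weight of a function: the number of points at which it does not vanish. -/
noncomputable def weight {α M : Type*} [Zero M] (f : α → M) : ℕ := (Function.support f).ncard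

theorem weight_pos {α M : Type*} [Zero M] [Finite α] {f : α → M} (hf : f ≠ 0) : 0 < weight f :=
  (Set.ncard_pos).2 (Function.support_nonempty_iff.2 hf)

variable {F V : Type*} [Field F] [AddCommGroup V] [Module F V] {l : Module.Dual F V} {f : V → F}

/-- The restriction of `f` to the flat `x + W`, as a function on `W`. -/
def restrictFlat (W : Submodule F V) (x : V) (f : V → F) : W → F := fun w => f (x + w)

theorem restrictFlat_mem_polyFun (W : Submodule F V) (x : V) {u : ℕ}
    (hf : f ∈ polyFun F V u) : restrictFlat W x f ∈ polyFun F W u :=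
  comp_affineMap_mem_polyFun (AffineMap.const F W x + W.subtype.toAffineMap) hf

theorem restrictFlat_ne_zero (W : Submodule F V) {x : V} (hx : f x ≠ 0) :
    restrictFlat W x f ≠ 0 :=
  fun h => hx (by simpa [restrictFlat] using congrFun h 0)

/-- The number of points of the hyperplane `l = a` at which `f` does not vanish. -/
noncomputable def levelWeight (l : Module.Dual F V) (f : V → F) (a : F) : ℕ :=
  (Function.support f ∩ l ⁻¹' {a}).ncard

theorem weight_restrictFlat_ker (l : Module.Dual F V) (f : V → F) (x : V) :
    weight (restrictFlat (LinearMap.ker l) x f) = levelWeight l f (l x) := by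
  have hinj : Function.Injective fun w : LinearMap.ker l => x + w :=
    (add_right_injective x).comp Subtype.val_injective
  rw [weight, levelWeight, ← Set.ncard_image_of_injective _ hinj]
  congr 1
  ext y
  constructor
  · rintro ⟨w, hw, rfl⟩
    exact ⟨hw, by simp⟩
  · rintro ⟨hy, hyx : l y = l x⟩
    exact ⟨⟨y - x, by simp [hyx]⟩, by simpa [restrictFlat] using hy, by simp⟩

theorem sum_levelWeight [Fintype F] [Finite V] (l : Module.Dual F V) (f : V → F) :
    ∑ a, levelWeight l f a = weight f := by
  rw [weight, ← Nat.card_coe_set_eq,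
    ← Nat.card_congr (Equiv.sigmaFiberEquiv fun x : Function.support f => l x), Nat.card_sigma]
  refine Finset.sum_congr rfl fun a _ => ?_
  rw [levelWeight, ← Subtype.image_preimage_coe,
    Set.ncard_image_of_injective _ Subtype.val_injective]
  rfl

variable [Fintype F]

open Classical in
/-- The values `a` such that `f` vanishes on the hyperplane `l = a`. -/
noncomputable def vanishingLevels (l : Module.Dual F V) (f : V → F) : Finset F :=
  Finset.univ.filter fun a => ∀ x, l x = a → f x = 0

theorem notMem_vanishingLevels {a : F} : a ∉ vanishingLevels l f ↔ ∃ x, l x = a ∧ f x ≠ 0 := by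
  simp [vanishingLevels]

theorem eq_zero_of_mem_vanishingLevels (x : V) (hx : l x ∈ vanishingLevels l f) : f x = 0 := by
  contrapose! hx
  exact notMem_vanishingLevels.2 ⟨x, rfl, hx⟩

theorem card_vanishingLevels_lt (l : Module.Dual F V) (hf : f ≠ 0) :
    (vanishingLevels l f).card < Fintype.card F := by
  obtain ⟨x, hx⟩ := Function.ne_iff.1 hf
  exact Finset.card_lt_univ_of_notMem (notMem_vanishingLevels.2 ⟨x, rfl, hx⟩)

theorem card_vanishingLevels_le (hl : l ≠ 0) {u : ℕ} (hfu : f ∈ polyFun F V u) (hf : f ≠ 0) :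
    (vanishingLevels l f).card ≤ u := by
  obtain ⟨n, -, -, hn, -⟩ :=
    exists_eq_hyperplaneProd_mul_of_vanish hl hfu hf eq_zero_of_mem_vanishingLevels
  omega

theorem restrictFlat_ker_mem_polyFun (hl : l ≠ 0) {u : ℕ} (hfu : f ∈ polyFun F V u) (hf : f ≠ 0)
    (x : V) : restrictFlat (LinearMap.ker l) x f ∈
      polyFun F (LinearMap.ker l) (u - (vanishingLevels l f).card) := by
  obtain ⟨n, g, hg, rfl, hfg⟩ :=
    exists_eq_hyperplaneProd_mul_of_vanish hl hfu hf eq_zero_of_mem_vanishingLevels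
  rw [Nat.add_sub_cancel]
  convert Submodule.smul_mem _ (∏ b ∈ vanishingLevels l f, (l x - b))
    (restrictFlat_mem_polyFun (LinearMap.ker l) x hg)
  ext w
  rw [restrictFlat, congrFun hfg]
  simp [restrictFlat, hyperplaneProd_apply]

variable [Finite V]

theorem sum_compl_vanishingLevels (l : Module.Dual F V) (f : V → F) [DecidableEq F] :
    ∑ a ∈ (vanishingLevels l f)ᶜ, levelWeight l f a = weight f := by
  rw [← sum_levelWeight l]
  refine Finset.sum_subset (Finset.subset_univ _) fun a _ ha => ?_
  rw [levelWeight, Set.ncard_eq_zero, Set.eq_empty_iff_forall_notMem]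
  rintro x ⟨hfx, rfl⟩
  exact hfx (eq_zero_of_mem_vanishingLevels x (by simpa using ha))

theorem weight_eq_pow_finrank (hf : ∀ x, f x ≠ 0) :
    weight f = Fintype.card F ^ Module.finrank F V := by
  rw [weight, Function.support_eq_univ hf, Set.ncard_univ,
    Module.natCard_eq_pow_finrank (K := F), Nat.card_eq_fintype_card]

theorem mul_le_weight {d : ℕ} (h : ∀ a ∉ vanishingLevels l f, d ≤ levelWeight l f a) :
    (Fintype.card F - (vanishingLevels l f).card) * d ≤ weight f := by
  classical
  rw [← sum_compl_vanishingLevels l, ← Finset.card_compl, ← smul_eq_mul]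
  exact Finset.card_nsmul_le_sum _ _ _ fun a ha => h a (Finset.mem_compl.1 ha)

theorem levelWeight_eq_of_weight_eq_mul {d : ℕ}
    (h : ∀ a ∉ vanishingLevels l f, d ≤ levelWeight l f a)
    (hw : weight f = (Fintype.card F - (vanishingLevels l f).card) * d) {a : F}
    (ha : a ∉ vanishingLevels l f) : levelWeight l f a = d := by
  classical
  refine ((Finset.sum_eq_sum_iff_of_le fun b hb => h b (Finset.mem_compl.1 hb)).1 ?_ a
    (Finset.mem_compl.2 ha)).symm
  rw [sum_compl_vanishingLevels, hw, Finset.sum_const, Finset.card_compl, smul_eq_mul]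

theorem minDist_le_weight {u : ℕ} (hfu : f ∈ polyFun F V u) (hf : f ≠ 0) :
    minDist (Fintype.card F) (Module.finrank F V) u ≤ weight f := by
  induction hm : Module.finrank F V generalizing V u with
  | zero => exact weight_pos hf
  | succ m ih =>
    have : Nontrivial V := Module.nontrivial_of_finrank_pos (R := F) (by omega)
    obtain ⟨l, hl⟩ := exists_ne (0 : Module.Dual F V)
    refine (minDist_le_mul (card_vanishingLevels_lt l hf) (card_vanishingLevels_le hl hfu hf)).trans
      (mul_le_weight fun a ha => ?_)
    obtain ⟨x, rfl, hx⟩ := notMem_vanishingLevels.1 ha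
    rw [← weight_restrictFlat_ker]
    exact ih (restrictFlat_ker_mem_polyFun hl hfu hf x) (restrictFlat_ne_zero _ hx)
      (by have := Module.Dual.finrank_ker_add_one_of_ne_zero hl; omega)

end Weight

section MinFun

variable (F V : Type*) [Field F] [Fintype F] [AddCommGroup V] [Module F V]

/-- The nonzero functions of degree at most `u` on a vector space whose weight is the minimum
distance: the minimum weight codewords, in a form that does not depend on coordinates. -/
def minFun (u : ℕ) : Set (V → F) :=
  {f | f ∈ polyFun F V u ∧ f ≠ 0 ∧ weight f = minDist (Fintype.card F) (Module.finrank F V) u}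

variable {F V} {l : Module.Dual F V} {f : V → F} {u : ℕ}

theorem comp_affineEquiv_mem_minFun {V' : Type*} [AddCommGroup V'] [Module F V']
    (hf : f ∈ minFun F V u) (e : V' ≃ᵃ[F] V) : f ∘ e ∈ minFun F V' u := by
  refine ⟨comp_affineMap_mem_polyFun e.toAffineMap hf.1, fun h => hf.2.1 ?_, ?_⟩
  · exact e.surjective.injective_comp_right (h : f ∘ e = (0 : V → F) ∘ e)
  · rw [e.linear.finrank_eq, ← hf.2.2, weight, weight, Function.support_comp_eq_preimage,
      Set.ncard_preimage_of_injective_subset_range e.injective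
        (by simp [e.surjective.range_eq])]

theorem eq_of_card_vanishingLevels_eq (hk : (vanishingLevels l f).card = Fintype.card F - 1)
    {x y : V} (hx : f x ≠ 0) (hy : f y ≠ 0) : l x = l y := by
  classical
  have hcompl : (vanishingLevels l f)ᶜ.card ≤ 1 := by rw [Finset.card_compl, hk]; omega
  exact Finset.card_le_one.1 hcompl _ (Finset.mem_compl.2 (notMem_vanishingLevels.2 ⟨x, rfl, hx⟩))
    _ (Finset.mem_compl.2 (notMem_vanishingLevels.2 ⟨y, rfl, hy⟩))

variable [Finite V]

theorem mem_minFun_zero : f ∈ minFun F V 0 ↔ ∃ c ≠ 0, f = fun _ => c := by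
  constructor
  · rintro ⟨hf, hf0, -⟩
    obtain ⟨c, rfl⟩ := mem_polyFun_zero.1 hf
    exact ⟨c, fun hc => hf0 (funext fun _ => hc), rfl⟩
  · rintro ⟨c, hc, rfl⟩
    exact ⟨const_mem_polyFun c 0, Function.ne_iff.2 ⟨0, hc⟩, by
      rw [weight_eq_pow_finrank fun _ => hc, minDist_zero_right]⟩

theorem minDist_finrank_ker_le_levelWeight (hl : l ≠ 0) (hfu : f ∈ polyFun F V u) (hf : f ≠ 0)
    {a : F} (ha : a ∉ vanishingLevels l f) :
    minDist (Fintype.card F) (Module.finrank F (LinearMap.ker l))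
      (u - (vanishingLevels l f).card) ≤ levelWeight l f a := by
  obtain ⟨x, rfl, hx⟩ := notMem_vanishingLevels.1 ha
  rw [← weight_restrictFlat_ker]
  exact minDist_le_weight (restrictFlat_ker_mem_polyFun hl hfu hf x) (restrictFlat_ne_zero _ hx)

theorem minDist_finrank_eq_mul (hf : f ∈ minFun F V u) (hl : l ≠ 0) :
    minDist (Fintype.card F) (Module.finrank F V) u =
      (Fintype.card F - (vanishingLevels l f).card) *
        minDist (Fintype.card F) (Module.finrank F (LinearMap.ker l))
          (u - (vanishingLevels l f).card) := by
  obtain ⟨hfu, hf0, hw⟩ := hf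
  refine le_antisymm ?_ ?_
  · rw [← Module.Dual.finrank_ker_add_one_of_ne_zero hl]
    exact minDist_le_mul (card_vanishingLevels_lt l hf0) (card_vanishingLevels_le hl hfu hf0)
  · rw [← hw]
    exact mul_le_weight fun a => minDist_finrank_ker_le_levelWeight hl hfu hf0

theorem levelWeight_eq_minDist (hf : f ∈ minFun F V u) (hl : l ≠ 0) {a : F}
    (ha : a ∉ vanishingLevels l f) :
    levelWeight l f a = minDist (Fintype.card F) (Module.finrank F (LinearMap.ker l))
      (u - (vanishingLevels l f).card) :=
  levelWeight_eq_of_weight_eq_mul (fun _ => minDist_finrank_ker_le_levelWeight hl hf.1 hf.2.1)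
    (hf.2.2.trans (minDist_finrank_eq_mul hf hl)) ha

theorem mul_levelWeight_eq_weight (hf : f ∈ minFun F V u) (hl : l ≠ 0) {a : F}
    (ha : a ∉ vanishingLevels l f) :
    (Fintype.card F - (vanishingLevels l f).card) * levelWeight l f a = weight f := by
  rw [levelWeight_eq_minDist hf hl ha, ← minDist_finrank_eq_mul hf hl, hf.2.2]

theorem restrictFlat_ker_mem_minFun (hf : f ∈ minFun F V u) (hl : l ≠ 0) {x : V} (hx : f x ≠ 0) :
    restrictFlat (LinearMap.ker l) x f ∈
      minFun F (LinearMap.ker l) (u - (vanishingLevels l f).card) :=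
  ⟨restrictFlat_ker_mem_polyFun hl hf.1 hf.2.1 x, restrictFlat_ne_zero _ hx, by
    rw [weight_restrictFlat_ker,
      levelWeight_eq_minDist hf hl (notMem_vanishingLevels.2 ⟨x, rfl, hx⟩)]⟩

theorem card_vanishingLevels_eq {t s : ℕ} (hs : s < Fintype.card F - 1)
    (hf : f ∈ minFun F V (t * (Fintype.card F - 1) + s)) (hl : l ≠ 0) :
    (vanishingLevels l f).card = 0 ∨ (vanishingLevels l f).card = s ∨
      (vanishingLevels l f).card = Fintype.card F - 1 := by
  have hmul := minDist_finrank_eq_mul hf hl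
  rw [← Module.Dual.finrank_ker_add_one_of_ne_zero hl] at hmul
  have := eq_of_minDist_eq_mul (card_vanishingLevels_lt l hf.2.1)
    (card_vanishingLevels_le hl hf.1 hf.2.1) hmul
  rwa [Nat.mul_add_mod_self_right, Nat.mod_eq_of_lt hs] at this

end MinFun

section MinFlat

variable {F V : Type*} [Field F] [Fintype F] [AddCommGroup V] [Module F V]

/-- The flat `x + W` has codimension `t`, contains the support of `f`, and `f` restricts on it to
a nonzero function of degree at most `s` of minimum weight. -/
structure IsMinFlat (W : Submodule F V) (x : V) (t s : ℕ) (f : V → F) : Prop where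
  finrank_add : Module.finrank F W + t = Module.finrank F V
  sub_mem : ∀ y, f y ≠ 0 → y - x ∈ W
  restrictFlat_mem : restrictFlat W x f ∈ minFun F W s

theorem isMinFlat_top {s : ℕ} {f : V → F} (hf : f ∈ minFun F V s) :
    IsMinFlat ⊤ 0 0 s f where
  finrank_add := finrank_top F V
  sub_mem _ _ := Submodule.mem_top
  restrictFlat_mem := by
    convert comp_affineEquiv_mem_minFun hf Submodule.topEquiv.toAffineEquiv
    simp [restrictFlat, funext_iff]

theorem IsMinFlat.apply_ne_zero {W : Submodule F V} {x : V} {t : ℕ} {f : V → F}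
    (hW : IsMinFlat W x t 0 f) (w : W) : f (x + w) ≠ 0 := by
  obtain ⟨c, hc⟩ := mem_polyFun_zero.1 hW.restrictFlat_mem.1
  intro hw
  refine hW.restrictFlat_mem.2.1 (hc.trans (funext fun _ => ?_))
  exact (congrFun hc w).symm.trans hw

theorem IsMinFlat.of_sub_mem {W : Submodule F V} {x y : V} {t s : ℕ} {f : V → F}
    (hW : IsMinFlat W x t s f) (hxy : y - x ∈ W) : IsMinFlat W y t s f where
  finrank_add := hW.finrank_add
  sub_mem z hz := by simpa using W.sub_mem (hW.sub_mem z hz) hxy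
  restrictFlat_mem := by
    convert comp_affineEquiv_mem_minFun hW.restrictFlat_mem
      (AffineEquiv.constVAdd F W (⟨y - x, hxy⟩ : W))
    ext w
    simp [restrictFlat, ← add_assoc]

theorem IsMinFlat.of_restrictFlat_ker [Module.Finite F V] {l : Module.Dual F V} (hl : l ≠ 0)
    {f : V → F} {x : V} (hx : ∀ y, f y ≠ 0 → l y = l x)
    {W : Submodule F (LinearMap.ker l)} {w : LinearMap.ker l} {t s : ℕ}
    (hW : IsMinFlat W w t s (restrictFlat (LinearMap.ker l) x f)) :
    IsMinFlat (W.map (LinearMap.ker l).subtype) (x + w) (t + 1) s f where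
  finrank_add := by
    rw [Submodule.finrank_map_subtype_eq, ← add_assoc, hW.finrank_add,
      Module.Dual.finrank_ker_add_one_of_ne_zero hl]
  sub_mem y hy := by
    refine ⟨⟨y - x, by simp [hx y hy]⟩ - w, hW.sub_mem _ (by simpa [restrictFlat] using hy), ?_⟩
    simp [sub_sub]
  restrictFlat_mem := by
    let φ := W.equivMapOfInjective (LinearMap.ker l).subtype (Submodule.subtype_injective _)
    convert comp_affineEquiv_mem_minFun hW.restrictFlat_mem φ.symm.toAffineEquiv
    ext y
    obtain ⟨y, rfl⟩ := φ.surjective y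
    simp [restrictFlat, φ, add_assoc]

end MinFlat

section ExistsMinFlat

variable {F V : Type*} [Field F] [AddCommGroup V] [Module F V] [Finite V]

theorem natCard_lt_levelWeight {f : V → F} {W : Submodule F V} {l : Module.Dual F V}
    (hWl : W ≤ LinearMap.ker l) {x p : V} (hxp : l x = l p) (hW : ∀ w ∈ W, f (x + w) ≠ 0)
    (hp : f p ≠ 0) (hpW : p - x ∉ W) : Nat.card W < levelWeight l f (l p) := by
  have hnotMem : p ∉ (x + ·) '' (W : Set V) := by
    rintro ⟨w, hw, rfl⟩
    exact hpW (by simpa using hw)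
  have hsubset : insert p ((x + ·) '' (W : Set V)) ⊆ Function.support f ∩ l ⁻¹' {l p} := by
    rintro _ (rfl | ⟨w, hw, rfl⟩)
    · exact ⟨hp, rfl⟩
    · exact ⟨hW w hw, by simp [hxp, LinearMap.mem_ker.1 (hWl hw)]⟩
  have hncard := Set.ncard_le_ncard hsubset
  rwa [Set.ncard_insert_of_notMem hnotMem, Set.ncard_image_of_injective _ (add_right_injective x)]
    at hncard

theorem exists_ker_ge_sup_span_singleton {W : Submodule F V}
    (hW : Module.finrank F W + 1 < Module.finrank F V) (z : V) :
    ∃ l : Module.Dual F V, l ≠ 0 ∧ W ≤ LinearMap.ker l ∧ l z = 0 := by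
  have hlt : W ⊔ F ∙ z < ⊤ := by
    refine Submodule.lt_top_of_finrank_lt_finrank ?_
    have := Submodule.finrank_add_le_finrank_add_finrank W (F ∙ z)
    have : Module.finrank F (F ∙ z) ≤ 1 := by
      simpa using finrank_span_le_card (R := F) ({z} : Set V)
    omega
  obtain ⟨l, hl, hker⟩ := Submodule.exists_le_ker_of_lt_top _ hlt
  exact ⟨l, hl, le_sup_left.trans hker,
    hker (Submodule.mem_sup_right (Submodule.mem_span_singleton_self z))⟩

variable [Fintype F]

theorem mul_card_dual_apply_eq_zero {z : V} (hz : z ≠ 0) :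
    Fintype.card F * Nat.card {l : Module.Dual F V // l z = 0} = Nat.card (Module.Dual F V) := by
  have heval : Module.Dual.eval F V z ≠ 0 := by
    rwa [Ne, Module.eval_apply_eq_zero_iff]
  rw [← Nat.card_eq_fintype_card, Module.natCard_eq_pow_finrank (K := F) (V := Module.Dual F V),
    ← Module.Dual.finrank_ker_add_one_of_ne_zero heval, pow_succ']
  exact congrArg _ (Module.natCard_eq_pow_finrank (V := LinearMap.ker (Module.Dual.eval F V z)))

theorem mul_sum_ncard_inter_level [Fintype (Module.Dual F V)] {S : Set V} {y : V} (hy : y ∉ S) :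
    Fintype.card F * ∑ l : Module.Dual F V, (S ∩ l ⁻¹' {l y}).ncard =
      S.ncard * Fintype.card (Module.Dual F V) := by
  classical
  lift S to Finset V using S.toFinite
  have hfilter (l : Module.Dual F V) :
      ((S : Set V) ∩ l ⁻¹' {l y}).ncard = (S.filter fun x => l x = l y).card := by
    rw [← Set.ncard_coe_finset, Finset.coe_filter]
    rfl
  have hcard (x) (hx : x ∈ S) : Fintype.card F *
      (Finset.univ.filter fun l : Module.Dual F V => l x = l y).card =
        Fintype.card (Module.Dual F V) := by
    have hxy : x - y ≠ 0 := sub_ne_zero.2 (ne_of_mem_of_not_mem hx hy)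
    rw [← Nat.card_eq_fintype_card (α := Module.Dual F V), ← mul_card_dual_apply_eq_zero hxy,
      Nat.card_eq_fintype_card, Fintype.card_subtype]
    simp only [map_sub, sub_eq_zero]
  calc Fintype.card F * ∑ l : Module.Dual F V, ((S : Set V) ∩ l ⁻¹' {l y}).ncard
      = Fintype.card F *
          ∑ x ∈ S, (Finset.univ.filter fun l : Module.Dual F V => l x = l y).card := by
        simp only [hfilter]
        exact congrArg _ (Finset.sum_card_bipartiteAbove_eq_sum_card_bipartiteBelow _)
    _ = (S : Set V).ncard * Fintype.card (Module.Dual F V) := by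
        rw [Finset.mul_sum, Finset.sum_congr rfl hcard, Finset.sum_const, smul_eq_mul,
          Set.ncard_coe_finset]

theorem exists_mul_ncard_inter_level_lt {S : Set V} (hS : S.Nonempty) {y : V} (hy : y ∉ S) :
    ∃ l : Module.Dual F V, l ≠ 0 ∧ Fintype.card F * (S ∩ l ⁻¹' {l y}).ncard < S.ncard := by
  have : Finite (Module.Dual F V) := Module.finite_of_finite F
  have := Fintype.ofFinite (Module.Dual F V)
  have hzero : S.ncard < Fintype.card F * (S ∩ (0 : Module.Dual F V) ⁻¹' {0}).ncard := by
    have hinter : S ∩ (0 : Module.Dual F V) ⁻¹' {0} = S := Set.inter_eq_left.2 fun _ _ => rfl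
    rw [hinter]
    exact lt_mul_of_one_lt_left ((Set.ncard_pos).2 hS) Fintype.one_lt_card
  by_contra! hle
  have hlt : ∑ _l : Module.Dual F V, S.ncard <
      ∑ l : Module.Dual F V, Fintype.card F * (S ∩ l ⁻¹' {l y}).ncard := by
    refine Finset.sum_lt_sum (fun l _ => ?_) ⟨0, Finset.mem_univ _, hzero⟩
    rcases eq_or_ne l 0 with rfl | hl
    · exact hzero.le
    · exact hle l hl
  rw [← Finset.mul_sum, mul_sum_ncard_inter_level hy, Finset.sum_const, smul_eq_mul,
    mul_comm] at hlt
  exact hlt.false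

theorem exists_card_vanishingLevels_ne_zero {u : ℕ} {f : V → F} (hf : f ∈ minFun F V u)
    (hu : 0 < u) (hV : 0 < Module.finrank F V) :
    ∃ l : Module.Dual F V, l ≠ 0 ∧ (vanishingLevels l f).card ≠ 0 := by
  obtain ⟨y, hy⟩ : ∃ y, f y = 0 := by
    by_contra! h
    obtain ⟨m, hm⟩ := Nat.exists_eq_succ_of_ne_zero hV.ne'
    refine (minDist_lt_pow (m := m) (Fintype.one_lt_card (α := F)) hu).ne ?_
    rw [← Nat.succ_eq_add_one, ← hm, ← hf.2.2, weight_eq_pow_finrank h]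
  obtain ⟨l, hl, hlt⟩ := exists_mul_ncard_inter_level_lt (F := F)
    (Function.support_nonempty_iff.2 hf.2.1) (Function.notMem_support.2 hy)
  refine ⟨l, hl, fun hk => hlt.ne ?_⟩
  have hmul := mul_levelWeight_eq_weight hf hl (a := l y) (by simp [Finset.card_eq_zero.1 hk])
  rwa [hk, Nat.sub_zero] at hmul

theorem exists_card_vanishingLevels_eq_of_flat {t s : ℕ} {f : V → F}
    (hs : s < Fintype.card F - 1) (hf : f ∈ minFun F V (t * (Fintype.card F - 1) + s))
    {W : Submodule F V} (hWt : Module.finrank F W + t + 1 = Module.finrank F V) (ht : 0 < t)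
    {x p : V} (hW : ∀ w ∈ W, f (x + w) ≠ 0) (hp : f p ≠ 0) (hpW : p - x ∉ W) :
    ∃ l : Module.Dual F V, l ≠ 0 ∧ (vanishingLevels l f).card = Fintype.card F - 1 := by
  obtain ⟨l, hl, hWl, hlp⟩ := exists_ker_ge_sup_span_singleton (F := F) (W := W)
    (by omega) (p - x)
  rw [map_sub, sub_eq_zero, eq_comm] at hlp
  -- On the level of `l` through `p` there are more points than a nonvanishing level can have if
  -- at most `s` levels vanish.
  have hlt := natCard_lt_levelWeight hWl hlp hW hp hpW
  have hmul := mul_levelWeight_eq_weight hf hl (notMem_vanishingLevels.2 ⟨p, rfl, hp⟩)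
  rw [hf.2.2, minDist_mul_add Fintype.card_pos (by omega),
    show Module.finrank F V - t = Module.finrank F W + 1 by omega, minDist_of_lt (by omega),
    ← Nat.card_eq_fintype_card, ← Module.natCard_eq_pow_finrank] at hmul
  have hgt : s < (vanishingLevels l f).card := by
    by_contra! hle
    refine hmul.not_gt (Nat.mul_lt_mul_of_le_of_lt (Nat.sub_le_sub_left hle _) hlt ?_)
    rw [Nat.card_eq_fintype_card]
    omega
  refine ⟨l, hl, ?_⟩
  have := card_vanishingLevels_eq hs hf hl
  omega

theorem card_vanishingLevels_eq_of_finrank_eq {t s : ℕ} {f : V → F}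
    (hf : f ∈ minFun F V (t * (Fintype.card F - 1) + s)) (ht : t = Module.finrank F V)
    {l : Module.Dual F V} (hl : l ≠ 0) :
    (vanishingLevels l f).card = Fintype.card F - 1 := by
  have hmul := minDist_finrank_eq_mul hf hl
  rw [← ht, minDist_mul_add Fintype.card_pos le_rfl, Nat.sub_self, minDist] at hmul
  have := Nat.eq_one_of_mul_eq_one_right hmul.symm
  omega

theorem exists_card_vanishingLevels_eq {t s : ℕ} (hs : s < Fintype.card F - 1) {f : V → F}
    (hf : f ∈ minFun F V ((t + 1) * (Fintype.card F - 1) + s))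
    (ht : t + 1 ≤ Module.finrank F V)
    (hflat : ∀ l : Module.Dual F V, l ≠ 0 → t + 1 ≤ Module.finrank F (LinearMap.ker l) →
      ∀ g ∈ minFun F (LinearMap.ker l) ((t + 1) * (Fintype.card F - 1)),
        ∃ W x, IsMinFlat W x (t + 1) 0 g) :
    ∃ l : Module.Dual F V, l ≠ 0 ∧ (vanishingLevels l f).card = Fintype.card F - 1 := by
  classical
  obtain ⟨l, hl, hk0⟩ := exists_card_vanishingLevels_ne_zero hf
    (Nat.add_pos_left (Nat.mul_pos t.succ_pos (by omega)) s) (by omega)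
  have hker := Module.Dual.finrank_ker_add_one_of_ne_zero hl
  rcases ht.eq_or_lt with ht | ht
  · exact ⟨l, hl, card_vanishingLevels_eq_of_finrank_eq hf ht hl⟩
  rcases card_vanishingLevels_eq hs hf hl with hk | hk | hk
  · exact absurd hk hk0
  · have hcompl : 1 < (vanishingLevels l f)ᶜ.card := by rw [Finset.card_compl]; omega
    obtain ⟨a, ha, b, hb, hab⟩ := Finset.one_lt_card.1 hcompl
    obtain ⟨x, rfl, hx⟩ := notMem_vanishingLevels.1 (Finset.mem_compl.1 ha)
    obtain ⟨p, rfl, hp⟩ := notMem_vanishingLevels.1 (Finset.mem_compl.1 hb)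
    have hg := restrictFlat_ker_mem_minFun hf hl hx
    rw [hk, Nat.add_sub_cancel] at hg
    obtain ⟨W, w, hW⟩ := hflat l hl (by omega) _ hg
    refine exists_card_vanishingLevels_eq_of_flat hs hf (W := W.map (LinearMap.ker l).subtype)
      (x := x + w) ?_ t.succ_pos ?_ hp ?_
    · rw [Submodule.finrank_map_subtype_eq, hW.finrank_add, hker]
    · rintro _ ⟨y, hy, rfl⟩
      simpa [restrictFlat, add_assoc] using hW.apply_ne_zero ⟨y, hy⟩
    · rintro ⟨y, -, hy⟩
      refine hab (sub_eq_zero.1 ?_).symm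
      simpa using (congrArg l hy).symm
  · exact ⟨l, hl, hk⟩

theorem exists_isMinFlat {t s : ℕ} (hs : s < Fintype.card F - 1) {f : V → F}
    (hf : f ∈ minFun F V (t * (Fintype.card F - 1) + s)) (ht : t ≤ Module.finrank F V) :
    ∃ W x, IsMinFlat W x t s f := by
  induction hm : Module.finrank F V generalizing V t s with
  | zero =>
    obtain rfl : t = 0 := by omega
    exact ⟨⊤, 0, isMinFlat_top (by simpa using hf)⟩
  | succ m ih =>
    cases t with
    | zero => exact ⟨⊤, 0, isMinFlat_top (by simpa using hf)⟩
    | succ t =>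
      have hfinrank {l : Module.Dual F V} (hl : l ≠ 0) :
          Module.finrank F (LinearMap.ker l) = m := by
        have := Module.Dual.finrank_ker_add_one_of_ne_zero hl
        omega
      obtain ⟨l, hl, hk⟩ := exists_card_vanishingLevels_eq hs hf ht fun l hl ht g hg =>
        ih (by omega) hg ht (hfinrank hl)
      obtain ⟨x, hx⟩ := Function.ne_iff.1 hf.2.1
      have hg := restrictFlat_ker_mem_minFun hf hl hx
      rw [hk, show (t + 1) * (Fintype.card F - 1) + s - (Fintype.card F - 1) =
        t * (Fintype.card F - 1) + s by rw [add_mul, one_mul]; omega] at hg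
      obtain ⟨W, w, hW⟩ := ih hs hg (by rw [hfinrank hl]; omega) (hfinrank hl)
      exact ⟨_, _, hW.of_restrictFlat_ker hl fun y hy =>
        eq_of_card_vanishingLevels_eq hk hy hx⟩

end ExistsMinFlat

section CountHyperplaneProd

variable {F V : Type*} [Field F] [AddCommGroup V] [Module F V] {l l' : Module.Dual F V}
  {B B' : Finset F} {c c' : F}

theorem smul_hyperplaneProd_apply_eq_zero (hc : c ≠ 0) {x : V} :
    (c • hyperplaneProd l B) x = 0 ↔ l x ∈ B := by
  simp [hc, hyperplaneProd_apply_eq_zero]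

theorem hyperplaneProd_smul [DecidableEq F] {a : F} (ha : a ≠ 0) (l : Module.Dual F V)
    (B : Finset F) :
    hyperplaneProd (a • l) B = a ^ B.card • hyperplaneProd l (B.image (a⁻¹ * ·)) := by
  ext x
  rw [Pi.smul_apply, hyperplaneProd_apply, hyperplaneProd_apply, smul_eq_mul,
    Finset.prod_image fun _ _ _ _ h => mul_right_injective₀ (inv_ne_zero ha) h,
    ← Finset.prod_const, ← Finset.prod_mul_distrib]
  refine Finset.prod_congr rfl fun b _ => ?_
  rw [mul_sub, mul_inv_cancel_left₀ ha, LinearMap.smul_apply, smul_eq_mul]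

variable [Fintype F]

theorem exists_apply_notMem (hl : l ≠ 0) (hB : B.card < Fintype.card F) : ∃ x, l x ∉ B := by
  obtain ⟨a, -, ha⟩ := Finset.exists_mem_notMem_of_card_lt_card (s := B) (t := Finset.univ) hB
  obtain ⟨x, rfl⟩ := LinearMap.surjective hl a
  exact ⟨x, ha⟩

theorem exists_smul_eq_of_smul_hyperplaneProd_eq (hl' : l' ≠ 0) (hc : c ≠ 0) (hc' : c' ≠ 0)
    (hB : B.Nonempty) (hB' : B'.card < Fintype.card F)
    (h : c • hyperplaneProd l B = c' • hyperplaneProd l' B') : ∃ a : F, a • l' = l := by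
  have hmem (x : V) : l x ∈ B ↔ l' x ∈ B' := by
    rw [← smul_hyperplaneProd_apply_eq_zero hc, h, smul_hyperplaneProd_apply_eq_zero hc']
  have hker : LinearMap.ker l' ≤ LinearMap.ker l := by
    intro w hw
    by_contra hlw
    rw [LinearMap.mem_ker] at hw hlw
    obtain ⟨b, hb⟩ := hB
    obtain ⟨x, hx⟩ := exists_apply_notMem hl' hB'
    have hmem := (hmem (x + ((b - l x) / l w) • w)).1 (by simpa [hlw] using hb)
    exact hx (by simpa [hw] using hmem)
  have := mem_span_of_iInf_ker_le_ker (L := fun _ : Unit => l') (K := l) (by simpa using hker)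
  rwa [Set.range_const, Submodule.mem_span_singleton] at this

theorem eq_of_smul_hyperplaneProd_eq (hl : l ≠ 0) (hc : c ≠ 0) (hc' : c' ≠ 0)
    (hB : B.card < Fintype.card F)
    (h : c • hyperplaneProd l B = c' • hyperplaneProd l B') : c = c' ∧ B = B' := by
  obtain rfl : B = B' := by
    ext a
    obtain ⟨x, rfl⟩ := LinearMap.surjective hl a
    rw [← smul_hyperplaneProd_apply_eq_zero hc, h, smul_hyperplaneProd_apply_eq_zero hc']
  obtain ⟨x, hx⟩ := exists_apply_notMem hl hB
  exact ⟨mul_right_cancel₀ (hyperplaneProd_apply_eq_zero.not.2 hx) (congrFun h x), rfl⟩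

theorem vanishingLevels_smul_hyperplaneProd (hl : l ≠ 0) (hc : c ≠ 0) (B : Finset F) :
    vanishingLevels l (c • hyperplaneProd l B) = B := by
  ext a
  obtain ⟨x, rfl⟩ := LinearMap.surjective hl a
  rw [← not_iff_not, notMem_vanishingLevels]
  simp only [ne_eq, smul_hyperplaneProd_apply_eq_zero hc]
  exact ⟨fun ⟨_, hyx, hy⟩ => hyx ▸ hy, fun hx => ⟨x, rfl, hx⟩⟩

variable [Finite V]

theorem weight_smul_hyperplaneProd (hl : l ≠ 0) (hc : c ≠ 0) (B : Finset F) :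
    weight (c • hyperplaneProd l B) =
      (Fintype.card F - B.card) * Fintype.card F ^ Module.finrank F (LinearMap.ker l) := by
  classical
  rw [← sum_compl_vanishingLevels l, vanishingLevels_smul_hyperplaneProd hl hc,
    ← Finset.card_compl, ← smul_eq_mul, ← Finset.sum_const]
  refine Finset.sum_congr rfl fun a ha => ?_
  obtain ⟨x, rfl⟩ := LinearMap.surjective hl a
  rw [← weight_restrictFlat_ker, weight_eq_pow_finrank]
  intro w
  rw [restrictFlat, Ne, smul_hyperplaneProd_apply_eq_zero hc, map_add, LinearMap.map_coe_ker,
    add_zero]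
  exact Finset.mem_compl.1 ha

theorem smul_hyperplaneProd_mem_minFun (hl : l ≠ 0) (hc : c ≠ 0)
    (hB : B.card < Fintype.card F) : c • hyperplaneProd l B ∈ minFun F V B.card := by
  refine ⟨Submodule.smul_mem _ c (hyperplaneProd_mem_polyFun l B), fun h => ?_, ?_⟩
  · obtain ⟨x, hx⟩ := exists_apply_notMem hl hB
    exact hx ((smul_hyperplaneProd_apply_eq_zero hc).1 (congrFun h x))
  · rw [weight_smul_hyperplaneProd hl hc, ← minDist_of_lt hB,
      Module.Dual.finrank_ker_add_one_of_ne_zero hl]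

theorem exists_eq_smul_hyperplaneProd {s : ℕ} (hs0 : 0 < s) (hs : s < Fintype.card F - 1)
    (hV : 0 < Module.finrank F V) {f : V → F} (hf : f ∈ minFun F V s) :
    ∃ l : Module.Dual F V, l ≠ 0 ∧ ∃ B : Finset F, B.card = s ∧ ∃ c : F, c ≠ 0 ∧
      f = c • hyperplaneProd l B := by
  obtain ⟨l, hl, hk0⟩ := exists_card_vanishingLevels_ne_zero hf hs0 hV
  have hk : (vanishingLevels l f).card = s := by
    have := card_vanishingLevels_eq (t := 0) hs (by simpa using hf) hl
    have := card_vanishingLevels_le hl hf.1 hf.2.1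
    omega
  obtain ⟨n, g, hg, hn, hfg⟩ := exists_eq_hyperplaneProd_mul_of_vanish hl hf.1 hf.2.1
    (B := vanishingLevels l f) eq_zero_of_mem_vanishingLevels
  obtain rfl : n = 0 := by omega
  obtain ⟨c, rfl⟩ := mem_polyFun_zero.1 hg
  refine ⟨l, hl, _, hk, c, ?_, hfg.trans (mul_comm _ _)⟩
  rintro rfl
  exact hf.2.1 (hfg.trans (mul_zero _))

open scoped LinearAlgebra.Projectivization

theorem bijOn_smul_hyperplaneProd {s : ℕ} (hs0 : 0 < s) (hs : s < Fintype.card F - 1)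
    (hV : 0 < Module.finrank F V) :
    Set.BijOn
      (fun p : ℙ F (Module.Dual F V) × F × Finset F => p.2.1 • hyperplaneProd p.1.rep p.2.2)
      (Set.univ ×ˢ {0}ᶜ ×ˢ {B | B.card = s}) (minFun F V s) := by
  classical
  refine ⟨?_, ?_, ?_⟩
  · rintro ⟨L, c, B⟩ ⟨-, hc, rfl : B.card = s⟩
    exact smul_hyperplaneProd_mem_minFun L.rep_nonzero hc (by omega)
  · rintro ⟨L, c, B⟩ ⟨-, hc : c ≠ 0, hB : B.card = s⟩ ⟨L', c', B'⟩ ⟨-, hc', hB' : B'.card = s⟩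
      (h : c • hyperplaneProd L.rep B = c' • hyperplaneProd L'.rep B')
    obtain rfl : L = L' := by
      rw [← L.mk_rep, ← L'.mk_rep, Projectivization.mk_eq_mk_iff']
      exact exists_smul_eq_of_smul_hyperplaneProd_eq L'.rep_nonzero hc hc'
        (Finset.card_pos.1 (by omega)) (by omega) h
    obtain ⟨rfl, rfl⟩ := eq_of_smul_hyperplaneProd_eq L.rep_nonzero hc hc' (by omega) h
    rfl
  · intro f hf
    obtain ⟨l, hl, B, hB, c, hc, rfl⟩ := exists_eq_smul_hyperplaneProd hs0 hs hV hf
    obtain ⟨a, ha⟩ := Projectivization.exists_smul_eq_mk_rep F l hl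
    refine ⟨⟨.mk F l hl, c * (a⁻¹ : F) ^ s, B.image ((a : F) * ·)⟩, ⟨trivial, ?_, ?_⟩, ?_⟩
    · exact mul_ne_zero hc (pow_ne_zero _ (inv_ne_zero a.ne_zero))
    · exact (Finset.card_image_of_injective _ (mul_right_injective₀ a.ne_zero)).trans hB
    · have hl : l = (a⁻¹ : F) • (Projectivization.mk F l hl).rep := by
        rw [← ha, ← Units.val_inv_eq_inv_val]
        exact (inv_smul_smul a l).symm
      conv_rhs => rw [hl]
      rw [hyperplaneProd_smul (inv_ne_zero a.ne_zero), inv_inv, hB]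
      exact mul_smul ..

end CountHyperplaneProd

section SubspaceCount

variable {F V : Type*} [Field F] [AddCommGroup V] [Module F V]

theorem exists_finrank_add_eq {t : ℕ} (ht : t ≤ Module.finrank F V) :
    ∃ W : Submodule F V, Module.finrank F W + t = Module.finrank F V := by
  obtain ⟨v, hv⟩ := exists_linearIndependent_of_le_finrank (Nat.sub_le (Module.finrank F V) t)
  refine ⟨Submodule.span F (Set.range v), ?_⟩
  rw [finrank_span_eq_card hv, Fintype.card_fin]
  omega

variable [Module.Finite F V]

theorem natCard_finrank_eq (k : ℕ) :
    Nat.card {W : Submodule F V // Module.finrank F W = k} =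
      qBinomial F (Module.finrank F V) k := by
  let e : V ≃ₗ[F] (Fin (Module.finrank F V) → F) := LinearEquiv.ofFinrankEq _ _ (by simp)
  refine Nat.card_congr ((Submodule.orderIsoMapComap e).toEquiv.subtypeEquiv fun W => ?_)
  change _ ↔ Module.finrank F (W.map e.toLinearMap) = k
  rw [LinearEquiv.finrank_map_eq]

theorem natCard_finrank_add_eq (t : ℕ) :
    Nat.card {W : Submodule F V // Module.finrank F W + t = Module.finrank F V} =
      qBinomial F (Module.finrank F V) t := by
  rw [← Subspace.dual_finrank_eq (K := F) (V := V), ← natCard_finrank_eq]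
  refine Nat.card_congr ((Subspace.orderIsoFiniteDimensional (K := F) (V := V)).toEquiv.trans
    OrderDual.ofDual |>.subtypeEquiv fun W => ?_)
  change _ ↔ Module.finrank F W.dualAnnihilator = t
  have := Subspace.finrank_add_finrank_dualAnnihilator_eq W
  rw [Subspace.dual_finrank_eq]
  omega

end SubspaceCount

section CountMinFun

open scoped LinearAlgebra.Projectivization

variable {F V : Type*} [Field F] [Fintype F] [AddCommGroup V] [Module F V] [Finite V]

theorem ncard_minFun_zero : (minFun F V 0).ncard = Fintype.card F - 1 := by
  classical
  have himage : minFun F V 0 = (fun c _ => c) '' ({0}ᶜ : Set F) := by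
    ext f
    simp [mem_minFun_zero, eq_comm]
  rw [himage, Set.ncard_image_of_injective _ fun c d h => congrFun h (0 : V), Set.ncard_compl,
    Set.ncard_singleton, Nat.card_eq_fintype_card]

theorem ncard_minFun_of_lt {s : ℕ} (hs0 : 0 < s) (hs : s < Fintype.card F - 1)
    (hV : 0 < Module.finrank F V) :
    (minFun F V s).ncard =
      (Fintype.card F - 1) * qBinomial F (Module.finrank F V) 1 * (Fintype.card F).choose s := by
  classical
  have hproj : Nat.card (ℙ F (Module.Dual F V)) = qBinomial F (Module.finrank F V) 1 := by
    rw [Nat.card_congr (Projectivization.equivSubmodule F _), natCard_finrank_eq,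
      Subspace.dual_finrank_eq]
  have hchoose : {B : Finset F | B.card = s}.ncard = (Fintype.card F).choose s := by
    rw [← Finset.card_univ, ← Finset.card_powersetCard, ← Set.ncard_coe_finset]
    congr 1
    ext B
    simp
  rw [← (bijOn_smul_hyperplaneProd hs0 hs hV).image_eq,
    (bijOn_smul_hyperplaneProd hs0 hs hV).injOn.ncard_image, Set.ncard_prod,
    Set.ncard_prod, Set.ncard_univ, hproj, hchoose, Set.ncard_compl, Set.ncard_singleton,
    Nat.card_eq_fintype_card]
  ring

end CountMinFun

section ExtendFlat

variable {F V : Type*} [Field F] [AddCommGroup V] [Module F V] {W W' : Submodule F V} {x x' : V}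
  {g : W → F} {g' : W' → F} {t s : ℕ}

open Classical in
/-- The function on `V` that is zero outside the flat `x + W` and restricts to `g` on it. -/
noncomputable def extendFlat (W : Submodule F V) (x : V) (g : W → F) : V → F :=
  fun y => if h : y - x ∈ W then g ⟨y - x, h⟩ else 0

theorem extendFlat_add (W : Submodule F V) (x : V) (g : W → F) (w : W) :
    extendFlat W x g (x + w) = g w := by
  simp [extendFlat]

theorem extendFlat_injective (W : Submodule F V) (x : V) :
    Function.Injective (extendFlat W x) := fun g g' h => funext fun w => by
  rw [← extendFlat_add W x g, h, extendFlat_add]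

theorem sub_mem_of_extendFlat_ne_zero {y : V} (h : extendFlat W x g y ≠ 0) : y - x ∈ W := by
  by_contra hy
  exact h (dif_neg hy)

theorem extendFlat_restrictFlat {f : V → F} (hf : ∀ y, f y ≠ 0 → y - x ∈ W) :
    extendFlat W x (restrictFlat W x f) = f := by
  ext y
  by_cases hy : y - x ∈ W
  · simp [extendFlat, restrictFlat, hy]
  · rw [extendFlat, dif_neg hy, not_imp_comm.1 (hf y) hy]

theorem weight_extendFlat (W : Submodule F V) (x : V) (g : W → F) :
    weight (extendFlat W x g) = weight g := by
  have hinj : Function.Injective fun w : W => x + w :=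
    (add_right_injective x).comp Subtype.val_injective
  rw [weight, weight, ← Set.ncard_image_of_injective _ hinj]
  congr 1
  ext y
  constructor
  · intro (hy : extendFlat W x g y ≠ 0)
    have hg := extendFlat_add W x g ⟨y - x, sub_mem_of_extendFlat_ne_zero hy⟩
    rw [add_sub_cancel] at hg
    exact ⟨_, hg ▸ hy, add_sub_cancel x y⟩
  · rintro ⟨w, hw, rfl⟩
    rwa [Function.mem_support, extendFlat_add]

theorem weight_le_natCard_inf [Finite V] {f : V → F} {y : V} (hy : f y ≠ 0)
    (hW : ∀ z, f z ≠ 0 → z - x ∈ W) (hW' : ∀ z, f z ≠ 0 → z - x' ∈ W') :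
    weight f ≤ Nat.card ↥(W ⊓ W') := by
  rw [weight, ← Set.ncard_preimage_of_injective_subset_range (add_right_injective y)
    fun z _ => ⟨z - y, add_sub_cancel y z⟩]
  refine Set.ncard_le_ncard fun z hz => ⟨?_, ?_⟩
  · simpa using W.sub_mem (hW _ hz) (hW y hy)
  · simpa using W'.sub_mem (hW' _ hz) (hW' y hy)

variable [Fintype F]

theorem one_sub_pow_card_sub_one_mem_polyFun (l : Module.Dual F V) :
    (fun y => 1 - l y ^ (Fintype.card F - 1)) ∈ polyFun F V (Fintype.card F - 1) := by
  have hl := SetLike.pow_mem_graded (Fintype.card F - 1) (dual_sub_const_mem_polyFun_one l 0)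
  rw [smul_eq_mul, mul_one] at hl
  simpa [Pi.sub_def, Pi.pow_def] using sub_mem (const_mem_polyFun 1 _) hl

open Classical in
theorem one_sub_pow_card_sub_one (a : F) :
    1 - a ^ (Fintype.card F - 1) = if a = 0 then 1 else 0 := by
  have : Fintype.card F - 1 ≠ 0 := by
    have := Fintype.one_lt_card (α := F)
    omega
  split_ifs with ha
  · rw [ha, zero_pow this, sub_zero]
  · rw [FiniteField.pow_card_sub_one_eq_one a ha, sub_self]

open Classical in
theorem indicator_mem_polyFun [Module.Finite F V]
    (ht : Module.finrank F W + t = Module.finrank F V) :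
    (fun y => if y ∈ W then (1 : F) else 0) ∈ polyFun F V (t * (Fintype.card F - 1)) := by
  have hquot : Module.finrank F (V ⧸ W) = t := by
    have := W.finrank_quotient_add_finrank
    omega
  let e : (V ⧸ W) ≃ₗ[F] (Fin t → F) := LinearEquiv.ofFinrankEq _ _ (by simp [hquot])
  let ψ (i : Fin t) : Module.Dual F V := LinearMap.proj i ∘ₗ e.toLinearMap ∘ₗ W.mkQ
  have hψ (y : V) : y ∈ W ↔ ∀ i, ψ i y = 0 := by
    rw [← Submodule.Quotient.mk_eq_zero, ← e.map_eq_zero_iff, funext_iff]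
    rfl
  have hprod := SetLike.prod_mem_graded (polyFun F V) (fun _ => Fintype.card F - 1) _
    fun i (_ : i ∈ Finset.univ) => one_sub_pow_card_sub_one_mem_polyFun (ψ i)
  convert hprod using 1
  · simp
  · ext y
    simp [hψ, one_sub_pow_card_sub_one, Finset.prod_ite_zero]

theorem extendFlat_mem_polyFun [Module.Finite F V]
    (ht : Module.finrank F W + t = Module.finrank F V) (x : V) (hg : g ∈ polyFun F W s) :
    extendFlat W x g ∈ polyFun F V (t * (Fintype.card F - 1) + s) := by
  classical
  obtain ⟨π, hπ⟩ := LinearMap.exists_leftInverse_of_injective W.subtype W.ker_subtype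
  let τ : V →ᵃ[F] V := AffineMap.id F V - AffineMap.const F V x
  have hτ (y : V) : τ y = y - x := by simp [τ]
  convert SetLike.mul_mem_graded (comp_affineMap_mem_polyFun τ (indicator_mem_polyFun ht))
    (comp_affineMap_mem_polyFun (π.toAffineMap.comp τ) hg) using 1
  ext y
  by_cases hy : y - x ∈ W
  · have hπy : π (y - x) = ⟨y - x, hy⟩ := LinearMap.congr_fun hπ ⟨y - x, hy⟩
    simp [extendFlat, hτ, hy, hπy, -map_sub]
  · simp [extendFlat, hτ, hy]

variable [Finite V]

theorem extendFlat_mem_minFun (ht : Module.finrank F W + t = Module.finrank F V) (x : V)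
    (hg : g ∈ minFun F W s) :
    extendFlat W x g ∈ minFun F V (t * (Fintype.card F - 1) + s) := by
  obtain ⟨hgs, hg0, hw⟩ := hg
  refine ⟨extendFlat_mem_polyFun ht x hgs, fun h => hg0 ?_, ?_⟩
  · exact funext fun w => (extendFlat_add W x g w).symm.trans (congrFun h _)
  · rw [weight_extendFlat, hw, minDist_mul_add Fintype.card_pos (by omega), ← ht,
      Nat.add_sub_cancel]

theorem eq_of_extendFlat_eq (hs : s < Fintype.card F - 1)
    (hWW' : Module.finrank F W = Module.finrank F W') (hg : g ∈ minFun F W s)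
    (h : extendFlat W x g = extendFlat W' x' g') : W = W' := by
  by_contra hne
  have hlt : W ⊓ W' < W := inf_lt_left.2 fun hle =>
    hne (Submodule.eq_of_le_of_finrank_eq hle hWW')
  obtain ⟨w, hw⟩ := Function.ne_iff.1 hg.2.1
  rw [← extendFlat_add W x g w] at hw
  have hle := weight_le_natCard_inf hw (fun _ => sub_mem_of_extendFlat_ne_zero)
    fun z hz => sub_mem_of_extendFlat_ne_zero (h ▸ hz)
  rw [weight_extendFlat, hg.2.2, Module.natCard_eq_pow_finrank (K := F),
    Nat.card_eq_fintype_card] at hle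
  refine (pow_lt_mul_minDist hs (Module.finrank F W)).not_ge ?_
  calc Fintype.card F * minDist (Fintype.card F) (Module.finrank F W) s
      ≤ Fintype.card F ^ (Module.finrank F ↥(W ⊓ W') + 1) := by
        rw [pow_succ']
        exact Nat.mul_le_mul_left _ hle
    _ ≤ Fintype.card F ^ Module.finrank F W :=
        Nat.pow_le_pow_right Fintype.card_pos (Submodule.finrank_lt_finrank_of_lt hlt)

end ExtendFlat

section CountFlat

variable {F V : Type*} [Field F] [Fintype F] [AddCommGroup V] [Module F V]

theorem ncard_minFun_congr {V' : Type*} [AddCommGroup V'] [Module F V'] (e : V' ≃ₗ[F] V) (u : ℕ) :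
    (minFun F V u).ncard = (minFun F V' u).ncard := by
  refine Set.ncard_congr (fun f _ => f ∘ e)
    (fun f hf => comp_affineEquiv_mem_minFun hf e.toAffineEquiv)
    (fun f f' _ _ h => e.surjective.injective_comp_right h) fun f hf => ⟨f ∘ e.symm,
      comp_affineEquiv_mem_minFun hf e.symm.toAffineEquiv, ?_⟩
  ext
  simp

variable [Finite V] {t s : ℕ}

theorem bijective_extendFlat (hs : s < Fintype.card F - 1) (ht : t ≤ Module.finrank F V) :
    Function.Bijective
      (fun p : (Σ W : {W : Submodule F V // Module.finrank F W + t = Module.finrank F V},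
          (V ⧸ W.1) × minFun F W.1 s) =>
        (⟨extendFlat p.1.1 p.2.1.out p.2.2.1, extendFlat_mem_minFun p.1.2 _ p.2.2.2⟩ :
          minFun F V (t * (Fintype.card F - 1) + s))) := by
  constructor
  · rintro ⟨⟨W, hW⟩, x, g, hg⟩ ⟨⟨W', hW'⟩, x', g', hg'⟩ h
    replace h : extendFlat W x.out g = extendFlat W' x'.out g' := congrArg Subtype.val h
    obtain rfl := eq_of_extendFlat_eq hs (Nat.add_right_cancel (hW.trans hW'.symm)) hg h
    obtain ⟨w, hw⟩ := Function.ne_iff.1 hg.2.1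
    rw [← extendFlat_add W x.out g w] at hw
    obtain rfl : x = x' := by
      have := W.sub_mem (sub_mem_of_extendFlat_ne_zero (h ▸ hw)) (sub_mem_of_extendFlat_ne_zero hw)
      rw [sub_sub_sub_cancel_left, ← Submodule.Quotient.eq] at this
      rwa [Submodule.Quotient.mk_out, Submodule.Quotient.mk_out] at this
    obtain rfl := extendFlat_injective W x.out h
    rfl
  · rintro ⟨f, hf⟩
    obtain ⟨W, x, hW⟩ := exists_isMinFlat hs hf ht
    have hz : (Submodule.Quotient.mk x : V ⧸ W).out - x ∈ W :=
      (Submodule.Quotient.eq W).1 (Submodule.Quotient.mk_out _)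
    replace hW := hW.of_sub_mem hz
    exact ⟨⟨⟨W, hW.finrank_add⟩, Submodule.Quotient.mk x, _, hW.restrictFlat_mem⟩,
      Subtype.ext (extendFlat_restrictFlat hW.sub_mem)⟩

theorem ncard_minFun_mul_add (hs : s < Fintype.card F - 1) (ht : t ≤ Module.finrank F V) :
    (minFun F V (t * (Fintype.card F - 1) + s)).ncard =
      Fintype.card F ^ t * qBinomial F (Module.finrank F V) t *
        (minFun F (Fin (Module.finrank F V - t) → F) s).ncard := by
  classical
  have : Finite (Submodule F V) := Finite.of_injective _ SetLike.coe_injective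
  have := Fintype.ofFinite {W : Submodule F V // Module.finrank F W + t = Module.finrank F V}
  have (W : Submodule F V) : Finite (V ⧸ W) := Finite.of_surjective _ W.mkQ_surjective
  have hcard (W : {W : Submodule F V // Module.finrank F W + t = Module.finrank F V}) :
      Nat.card ((V ⧸ W.1) × minFun F W.1 s) =
        Fintype.card F ^ t * (minFun F (Fin (Module.finrank F V - t) → F) s).ncard := by
    have hW : Module.finrank F W.1 = Module.finrank F V - t := Nat.eq_sub_of_add_eq W.2
    have hquot : Module.finrank F (V ⧸ W.1) = t := by
      have := W.1.finrank_quotient_add_finrank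
      omega
    let e : (Fin (Module.finrank F V - t) → F) ≃ₗ[F] W.1 :=
      LinearEquiv.ofFinrankEq _ _ (by rw [Module.finrank_fin_fun, hW])
    rw [Nat.card_prod, Module.natCard_eq_pow_finrank (K := F), Nat.card_eq_fintype_card,
      Nat.card_coe_set_eq, ncard_minFun_congr e, hquot]
  rw [← Nat.card_coe_set_eq, ← Nat.card_congr (Equiv.ofBijective _ (bijective_extendFlat hs ht)),
    Nat.card_sigma, Finset.sum_congr rfl fun W _ => hcard W, Finset.sum_const, Finset.card_univ,
    ← Nat.card_eq_fintype_card, natCard_finrank_add_eq, smul_eq_mul]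
  ring

theorem minFun_nonempty_of_lt (hs : s < Fintype.card F) (hV : 0 < Module.finrank F V) :
    (minFun F V s).Nonempty := by
  have : Nontrivial V := Module.nontrivial_of_finrank_pos hV
  obtain ⟨l, hl⟩ := exists_ne (0 : Module.Dual F V)
  obtain ⟨B, -, rfl⟩ := Finset.exists_subset_card_eq (s := (Finset.univ : Finset F)) hs.le
  exact ⟨_, smul_hyperplaneProd_mem_minFun hl one_ne_zero hs⟩

theorem minFun_nonempty {u : ℕ} (hu : u ≤ Module.finrank F V * (Fintype.card F - 1)) :
    (minFun F V u).Nonempty := by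
  have hq : 0 < Fintype.card F - 1 := Nat.sub_pos_of_lt Fintype.one_lt_card
  obtain ⟨⟨t, s⟩, ⟨ht, hs, rfl⟩, -⟩ := existsUnique_mul_add hq hu
  obtain ⟨W, hW⟩ := exists_finrank_add_eq ht
  suffices h : (minFun F W s).Nonempty from
    h.elim fun g hg => ⟨_, extendFlat_mem_minFun hW 0 hg⟩
  rcases Nat.eq_zero_or_pos s with rfl | hs0
  · exact ⟨_, mem_minFun_zero.2 ⟨1, one_ne_zero, rfl⟩⟩
  · have hlt : t < Module.finrank F V :=
      lt_of_mul_lt_mul_right ((Nat.lt_add_of_pos_right hs0).trans_le hu) hq.le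
    exact minFun_nonempty_of_lt (by omega) (by omega)

end CountFlat

section ReedMuller

theorem evalₗ_mem_polyFun {R ι : Type*} [CommRing R] [Finite ι] {u : ℕ}
    {p : MvPolynomial ι R} (hp : p.totalDegree ≤ u) :
    MvPolynomial.evalₗ R ι p ∈ polyFun R (ι → R) u := by
  have := Fintype.ofFinite ι
  rw [p.as_sum, map_sum]
  refine sum_mem fun e he => polyFun_mono ((MvPolynomial.le_totalDegree he).trans hp) ?_
  have hcoord (i : ι) : (fun x : ι → R => x i) ∈ polyFun R (ι → R) 1 :=
    affineMap_mem_polyFun_one (LinearMap.proj i : (ι → R) →ₗ[R] R).toAffineMap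
  have hprod := SetLike.prod_pow_mem_graded (polyFun R (ι → R)) (fun _ => 1)
    (fun i x => x i) e fun i (_ : i ∈ Finset.univ) => hcoord i
  convert Submodule.smul_mem _ (p.coeff e) hprod using 1
  · rw [Finsupp.sum_fintype _ _ fun _ => rfl]
    simp
  · ext x
    simp [MvPolynomial.evalₗ_apply, MvPolynomial.eval_monomial, Finsupp.prod_fintype]

theorem exists_totalDegree_le_one_eval_eq {R ι : Type*} [CommRing R] [Finite ι]
    (α : (ι → R) →ᵃ[R] R) :
    ∃ p : MvPolynomial ι R, p.totalDegree ≤ 1 ∧ ∀ x, MvPolynomial.eval x p = α x := by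
  classical
  have := Fintype.ofFinite ι
  let p := (LinearMap.toMatrix' (LinearMap.pi fun _ : Unit => α.linear)).toMvPolynomial ()
  refine ⟨p + MvPolynomial.C (α 0), (MvPolynomial.totalDegree_add _ _).trans
    (max_le (Matrix.toMvPolynomial_totalDegree_le _ _) (by simp)), fun x => ?_⟩
  rw [map_add, Matrix.toMvPolynomial_eval_eq_apply, LinearMap.toMatrix'_mulVec,
    MvPolynomial.eval_C, α.decomp]
  simp

theorem reedMuller_eq_polyFun (F : Type*) [Field F] (u m : ℕ) :
    reedMuller F u m = polyFun F (Fin m → F) u := by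
  refine le_antisymm ?_ fun f hf => ?_
  · rintro _ ⟨p, hp, rfl⟩
    exact evalₗ_mem_polyFun ((MvPolynomial.mem_restrictTotalDegree _ _ _).1 hp)
  · induction hf using Submodule.pow_induction_on_left' with
    | algebraMap r =>
      refine ⟨MvPolynomial.C r, (MvPolynomial.mem_restrictTotalDegree _ _ _).2 (by simp), ?_⟩
      ext x
      simp [MvPolynomial.evalₗ_apply]
    | add f g i _ _ hf hg => exact add_mem hf hg
    | mem_mul α hα i f _ hf =>
      obtain ⟨α, rfl⟩ := hα
      obtain ⟨p, hp, rfl⟩ := hf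
      obtain ⟨a, ha, haα⟩ := exists_totalDegree_le_one_eval_eq α
      have hp : p.totalDegree ≤ i := (MvPolynomial.mem_restrictTotalDegree _ _ _).1 hp
      refine ⟨a * p, (MvPolynomial.mem_restrictTotalDegree _ _ _).2
        ((MvPolynomial.totalDegree_mul a p).trans (by omega)), ?_⟩
      ext x
      simp [MvPolynomial.evalₗ_apply, haα]

theorem hammingNorm_eq_weight {α M : Type*} [Fintype α] [Zero M] [DecidableEq M] (f : α → M) :
    hammingNorm f = weight f := by
  rw [hammingNorm, weight, ← Set.ncard_coe_finset]
  simp [Function.support]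

theorem minWeightCodewords_reedMuller {F : Type*} [Field F] [Fintype F] [DecidableEq F] {u m : ℕ}
    (hu : u ≤ m * (Fintype.card F - 1)) :
    minWeightCodewords (reedMuller F u m) = minFun F (Fin m → F) u := by
  obtain ⟨g, hgu, hg0, hg⟩ : (minFun F (Fin m → F) u).Nonempty :=
    minFun_nonempty (by rwa [Module.finrank_fin_fun])
  ext f
  simp only [minWeightCodewords, minFun, reedMuller_eq_polyFun, hammingNorm_eq_weight,
    Set.mem_ofPred_eq]
  exact ⟨fun ⟨hfu, hf0, hf⟩ => ⟨hfu, hf0, ((hf g hgu hg0).trans_eq hg).antisymm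
    (minDist_le_weight hfu hf0)⟩, fun ⟨hfu, hf0, hf⟩ => ⟨hfu, hf0, fun c hcu hc0 =>
    hf.trans_le (minDist_le_weight hcu hc0)⟩⟩

end ReedMuller

theorem mainTheorem9 {F : Type*} [Field F] [Fintype F] [DecidableEq F]
    (q : ℕ) (hq : Fintype.card F = q) (m : ℕ) (hm : 1 ≤ m) (u : ℕ) (hu : u ≤ m * (q - 1)) :
    (∃! p : ℕ × ℕ, p.1 ≤ m ∧ p.2 < q - 1 ∧ u = p.1 * (q - 1) + p.2) ∧
    ∀ t s : ℕ, t ≤ m → s < q - 1 → u = t * (q - 1) + s →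
      (minWeightCodewords (reedMuller F u m)).ncard =
        if s = 0 then (q - 1) * q ^ t * qBinomial F m t
        else (q - 1) * q ^ t * qBinomial F m t * qBinomial F (m - t) 1 * q.choose s := by
  subst hq
  have hq : 0 < Fintype.card F - 1 := Nat.sub_pos_of_lt Fintype.one_lt_card
  refine ⟨existsUnique_mul_add hq hu, ?_⟩
  rintro t s ht hs rfl
  rw [minWeightCodewords_reedMuller hu, ncard_minFun_mul_add hs (by rwa [Module.finrank_fin_fun]),
    Module.finrank_fin_fun]
  split_ifs with hs0
  · rw [hs0, ncard_minFun_zero]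
    ring
  · have htm : t < m := lt_of_mul_lt_mul_right
      ((Nat.lt_add_of_pos_right (Nat.pos_of_ne_zero hs0)).trans_le hu) hq.le
    rw [ncard_minFun_of_lt (Nat.pos_of_ne_zero hs0) hs
      (by rw [Module.finrank_fin_fun]; exact Nat.sub_pos_of_lt htm), Module.finrank_fin_fun]
    ring
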